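/- Let $\mathcal{E}$ be an elementary topos with chosen finite products, let $(\Sigma,E)$ be a variety (a set $\Sigma$ of operation symbols of finite arities and a set $E$ of equations between $\Sigma$-terms in finitely many variables), and let $(Q,\otimes,k,\bigvee)$ be an internal commutative quantale in $\mathcal{E}$, that is, an internal partial order with a join morphism $\bigvee:\Omega^Q\to Q$ and an internal commutative monoid structure whose multiplication preserves joins in each argument. All formulas below are read in the internal language of $\mathcal{E}$. A $Q$-relation from $A$ to $B$ is a morphism $R:A\times B\to Q$ of $\mathcal{E}$. For $(\Sigma,E)$-algebras $A,B$ in $\mathcal{E}$ it is called algebraic if, for every $n$ and every $n$-ary $\sigma\in\Sigma$, $$R(a_1,b_1)\otimes\cdots\otimes R(a_n,b_n)\le R(\sigma(a_1,\dots,a_n),\sigma(b_1,\dots,b_n)).$$ For $Q$-relations put $R\subseteq R'$ iff $\forall a,b.\ R(a,b)\le R'(a,b)$. Theorem. The $(\Sigma,E)$-algebras in $\mathcal{E}$ and the algebraic $Q$-relations between them form a partially ordered symmetric monoidal category $\mathbf{Rel}_{(\Sigma,E)}(Q)$, with the following structure. - The identities are $1_A(a,a')=\bigvee\{k\mid a=a'\}$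 and the composition is $(S\circ R)(a,c)=\bigvee_b R(a,b)\otimes S(b,c)$. - The tensor product of objects is the product of algebras, the monoidal unit is the terminal algebra, and $(R\otimes R')((a,a'),(b,b'))=R(a,b)\otimes R'(a',b')$. - The associators, the left and right unitors and the symmetries are the graphs $f_\circ(a,b)=\bigvee\{k\mid f(a)=b\}$ of the corresponding canonical isomorphisms $f$ of the finite products in $\mathcal{E}$. - The relation $\subseteq$ is a partial order on each hom-set, and composition and tensor are monotone in both arguments: if $R\subseteq R'$ and $S\subseteq S'$, then $S\circ R\subseteq S'\circ R'$ (for composable relations) and $R\otimes S\subseteq R'\otimes S'$. -/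

import Mathlib

open CategoryTheory Limits MonoidalCategory CartesianMonoidalCategory MonObj

universe v u w

namespace QRel

/-! An elementary topos is a category `C` with finite limits (with chosen finite products, i.e. a
`CartesianMonoidalCategory`), exponentials and a subobject classifier.

Statements in the internal language are spelled out on generalized elements `x : X ⟶ A`
(Kripke–Joyal semantics): an internal universal quantifier or implication becomes a quantifier over
all generalized elements at all later stages `Z ⟶ X`. -/

/-- An internal partially ordered object: an order relation `≤`, given as a subobject of
`obj ⊗ obj`, which is reflexive, transitive and antisymmetric. -/
structure InternalPoset (C : Type u) [Category.{v} C] [CartesianMonoidalCategory C] where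
  obj : C
  rel : Subobject (obj ⊗ obj)
  refl : ∀ {X : C} (a : X ⟶ obj), rel.Factors (lift a a)
  trans : ∀ {X : C} (a b c : X ⟶ obj),
    rel.Factors (lift a b) → rel.Factors (lift b c) → rel.Factors (lift a c)
  antisymm : ∀ {X : C} (a b : X ⟶ obj),
    rel.Factors (lift a b) → rel.Factors (lift b a) → a = b

namespace InternalPoset

variable {C : Type u} [Category.{v} C] [CartesianMonoidalCategory C]

/-- The internal order on generalized elements. -/
def LE (Q : InternalPoset C) {X : C} (a b : X ⟶ Q.obj) : Prop :=
  Q.rel.Factors (lift a b)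

/-- A predicate `P x b` on pairs of generalized elements `x` of `X` and `b` of `Q` at a common stage
describes an internal family of sets `{b | P x b}` of elements of `Q`, indexed by `x` in `X`.
`Q.IsJoin P s` says that internally `s x = ⋁ {b | P x b}` for all `x`: the
element `s x` is below `q` exactly when every `b` with `P x b` is below `q`. -/
def IsJoin (Q : InternalPoset C) {X : C}
    (P : ∀ ⦃Z : C⦄, (Z ⟶ X) → (Z ⟶ Q.obj) → Prop) (s : X ⟶ Q.obj) : Prop :=
  ∀ ⦃Y : C⦄ (x : Y ⟶ X) (q : Y ⟶ Q.obj),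
    Q.LE (x ≫ s) q ↔ ∀ ⦃Z : C⦄ (z : Z ⟶ Y) (b : Z ⟶ Q.obj), P (z ≫ x) b → Q.LE b (z ≫ q)

end InternalPoset

section Topos

variable {C : Type u} [Category.{v} C] [CartesianMonoidalCategory C]
  [MonoidalClosed C] [HasSubobjectClassifier C]

/-- The power object `Ω ^ A`. -/
noncomputable abbrev power (A : C) : C := (ihom A).obj (HasSubobjectClassifier.Ω C)

/-- The membership relation `b ∈ S`, for generalized elements of `A` and of its power object. -/
def Mem {A X : C} (b : X ⟶ A) (S : X ⟶ power A) : Prop :=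
  lift b S ≫ (ihom.ev A).app (HasSubobjectClassifier.Ω C) =
    Subobject.Classifier.χ₀ _ X ≫ HasSubobjectClassifier.truth C

/-- An internal (unital) quantale: an internal partial order with a join operation `Ω ^ Q ⟶ Q` and
an internal monoid structure which preserves joins in each argument. Products of generalized
elements are those of Mathlib's monoid structure on `X ⟶ obj`. -/
structure InternalQuantale (C : Type u) [Category.{v} C] [CartesianMonoidalCategory C]
    [MonoidalClosed C] [HasSubobjectClassifier C] extends InternalPoset C where
  mon : MonObj obj
  sup : power obj ⟶ obj
  isJoin_sup : ∀ {X : C} (S : X ⟶ power obj),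
    toInternalPoset.IsJoin (fun _ x b => Mem b (x ≫ S)) (S ≫ sup)
  mul_sup : ∀ {X : C} (a : X ⟶ obj) (S : X ⟶ power obj),
    toInternalPoset.IsJoin (fun _ x c => ∃ b, Mem b (x ≫ S) ∧ c = (x ≫ a) * b) (a * (S ≫ sup))
  sup_mul : ∀ {X : C} (S : X ⟶ power obj) (b : X ⟶ obj),
    toInternalPoset.IsJoin (fun _ x c => ∃ a, Mem a (x ≫ S) ∧ c = a * (x ≫ b)) ((S ≫ sup) * b)

attribute [instance] InternalQuantale.mon

/-- Commutativity of an internal quantale. -/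
def InternalQuantale.IsCommutative (Q : InternalQuantale C) : Prop :=
  ∀ {X : C} (a b : X ⟶ Q.obj), a * b = b * a

end Topos

/-- A variety `(Σ, E)`: operation symbols of finite arities, and a set of equations between terms in
finitely many variables. -/
structure Variety where
  Op : ℕ → Type w
  eqs : ∀ n : ℕ, Set
    ((FirstOrder.Language.mk Op fun _ => Empty).Term (Fin n) ×
      (FirstOrder.Language.mk Op fun _ => Empty).Term (Fin n))

/-- The terms of a variety over a set of variables. -/
abbrev Variety.Term (V : Variety.{w}) (α : Type) : Type w :=
  (FirstOrder.Language.mk V.Op fun _ => Empty).Term α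

section Algebra

variable {C : Type u} [Category.{v} C] [HasFiniteLimits C]

/-- The value of a term at generalized elements of `A`, given operations on `A`. -/
noncomputable def termValue (V : Variety.{w}) {A : C}
    (op : ∀ {n : ℕ}, V.Op n → ((∏ᶜ fun _ : Fin n => A) ⟶ A)) {X : C} {α : Type}
    (a : α → (X ⟶ A)) : V.Term α → (X ⟶ A)
  | .var i => a i
  | .func σ ts => Pi.lift (fun i => termValue V op a (ts i)) ≫ op σ

/-- A `(Σ, E)`-algebra in `C`. -/
structure Alg (V : Variety.{w}) (C : Type u) [Category.{v} C] [HasFiniteLimits C] where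
  carrier : C
  op : ∀ {n : ℕ}, V.Op n → ((∏ᶜ fun _ : Fin n => carrier) ⟶ carrier)
  sat : ∀ (n : ℕ) (e : V.Term (Fin n) × V.Term (Fin n)), e ∈ V.eqs n →
    ∀ {X : C} (a : Fin n → (X ⟶ carrier)), termValue V op a e.1 = termValue V op a e.2

variable {V : Variety.{w}}

/-- `σ(a₁, …, aₙ)` for generalized elements `a₁, …, aₙ` of an algebra. -/
noncomputable def Alg.app (A : Alg V C) {n : ℕ} (σ : V.Op n) {X : C}
    (a : Fin n → (X ⟶ A.carrier)) : X ⟶ A.carrier :=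
  Pi.lift a ≫ A.op σ

/-- Operations compatible with a morphism commute with evaluation of terms. -/
theorem termValue_comp {A B : C}
    (opA : ∀ {n : ℕ}, V.Op n → ((∏ᶜ fun _ : Fin n => A) ⟶ A))
    (opB : ∀ {n : ℕ}, V.Op n → ((∏ᶜ fun _ : Fin n => B) ⟶ B)) (f : A ⟶ B)
    (hf : ∀ {n : ℕ} (σ : V.Op n), opA σ ≫ f = Limits.Pi.map (fun _ => f) ≫ opB σ)
    {X : C} {α : Type} (a : α → (X ⟶ A)) (t : V.Term α) :
    termValue V opA a t ≫ f = termValue V opB (fun i => a i ≫ f) t := by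
  induction t with
  | var i => rfl
  | func σ ts ih =>
    simp only [termValue, Category.assoc, hf]
    rw [← Category.assoc]
    congr 1
    ext i
    simp [ih]

variable [CartesianMonoidalCategory C]

/-- The product of two algebras, with componentwise operations. -/
noncomputable abbrev Alg.prod (A B : Alg V C) : Alg V C where
  carrier := A.carrier ⊗ B.carrier
  op σ := lift (Limits.Pi.map (fun _ => fst A.carrier B.carrier) ≫ A.op σ)
    (Limits.Pi.map (fun _ => snd A.carrier B.carrier) ≫ B.op σ)
  sat n e he X a := by
    apply CartesianMonoidalCategory.hom_ext
    · rw [termValue_comp _ A.op (fst A.carrier B.carrier) (by intros; simp),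
        termValue_comp _ A.op (fst A.carrier B.carrier) (by intros; simp), A.sat n e he]
    · rw [termValue_comp _ B.op (snd A.carrier B.carrier) (by intros; simp),
        termValue_comp _ B.op (snd A.carrier B.carrier) (by intros; simp), B.sat n e he]

/-- The terminal algebra. -/
noncomputable abbrev Alg.unit : Alg V C where
  carrier := 𝟙_ C
  op _ := toUnit _
  sat _ _ _ _ _ := toUnit_unique _ _

end Algebra

section Relations

variable {C : Type u} [Category.{v} C] [HasFiniteLimits C] [CartesianMonoidalCategory C]
  [MonoidalClosed C] [HasSubobjectClassifier C]

/-- A `Q`-relation between objects `A` and `B`. -/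
abbrev Rel (Q : InternalQuantale C) (A B : C) : Type v := A ⊗ B ⟶ Q.obj

namespace Rel

variable {Q : InternalQuantale C}

/-- The truth value `R(a, b)`. -/
def val {A B : C} (R : Rel Q A B) {X : C} (a : X ⟶ A) (b : X ⟶ B) : X ⟶ Q.obj :=
  lift a b ≫ R

/-- The order on `Q`-relations: `∀ a b, R(a, b) ≤ R'(a, b)`. -/
def Sub {A B : C} (R R' : Rel Q A B) : Prop :=
  ∀ ⦃X : C⦄ (a : X ⟶ A) (b : X ⟶ B), Q.LE (R.val a b) (R'.val a b)

/-- `T` is the graph of `f`: `T(a, b) = ⋁ {k | f(a) = b}`. -/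
def IsGraph {A B : C} (f : A ⟶ B) (T : Rel Q A B) : Prop :=
  Q.IsJoin (X := A ⊗ B) (fun _ x t => (x ≫ fst A B) ≫ f = x ≫ snd A B ∧ t = 1) T

/-- `T` is the identity relation: `T(a, a') = ⋁ {k | a = a'}`. -/
def IsIdentity {A : C} (T : Rel Q A A) : Prop :=
  Q.IsJoin (X := A ⊗ A) (fun _ x t => x ≫ fst A A = x ≫ snd A A ∧ t = 1) T

/-- `T` is the composite of `R : A → B` and `S : B → D`:
`T(a, d) = ⋁_b R(a, b) ⊗ S(b, d)`. -/
def IsComposite {A B D : C} (R : Rel Q A B) (S : Rel Q B D) (T : Rel Q A D) : Prop :=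
  Q.IsJoin (X := A ⊗ D)
    (fun Z x t => ∃ b : Z ⟶ B, t = R.val (x ≫ fst A D) b * S.val b (x ≫ snd A D)) T

/-- The tensor of relations: `(R ⊗ R')((a, a'), (b, b')) = R(a, b) ⊗ R'(a', b')`. -/
def tensor {A B A' B' : C} (R : Rel Q A B) (R' : Rel Q A' B') : Rel Q (A ⊗ A') (B ⊗ B') :=
  R.val (fst (A ⊗ A') (B ⊗ B') ≫ fst A A') (snd (A ⊗ A') (B ⊗ B') ≫ fst B B') *
    R'.val (fst (A ⊗ A') (B ⊗ B') ≫ snd A A') (snd (A ⊗ A') (B ⊗ B') ≫ snd B B')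

end Rel

/-- Algebraic `Q`-relations:
`R(a₁, b₁) ⊗ ⋯ ⊗ R(aₙ, bₙ) ≤ R(σ(a₁, …, aₙ), σ(b₁, …, bₙ))` for every operation `σ`. -/
def IsAlgebraic {V : Variety.{w}} (Q : InternalQuantale C) (A B : Alg V C)
    (R : Rel Q A.carrier B.carrier) : Prop :=
  ∀ ⦃n : ℕ⦄ (σ : V.Op n) ⦃X : C⦄ (a : Fin n → (X ⟶ A.carrier)) (b : Fin n → (X ⟶ B.carrier)),
    Q.LE (List.ofFn fun i => R.val (a i) (b i)).prod (R.val (A.app σ a) (B.app σ b))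

/-- The type of algebraic `Q`-relations between two algebras. -/
def AlgRel {V : Variety.{w}} (Q : InternalQuantale C) (A B : Alg V C) : Type v :=
  {R : Rel Q A.carrier B.carrier // IsAlgebraic Q A B R}

namespace AlgRel

variable {V : Variety.{w}} {Q : InternalQuantale C}

/-- The `Q`-relation underlying an algebraic `Q`-relation, viewed as a relation between algebras
`A'` and `B'` that are equal to the given ones. -/
def relOf {A B A' B' : Alg V C} (hA : A = A') (hB : B = B') (R : AlgRel Q A B) :
    Rel Q A'.carrier B'.carrier := by
  subst hA hB
  exact R.1

/-- The underlying `Q`-relation. -/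
abbrev rel {A B : Alg V C} (R : AlgRel Q A B) : Rel Q A.carrier B.carrier := R.1

end AlgRel

end Relations

/-- A partially ordered symmetric monoidal category: a symmetric monoidal category with a partial
order on every hom-set, such that composition and tensor are monotone in both arguments. -/
structure IsPartiallyOrderedSMC (R : Type u) [Category.{v} R] [MonoidalCategory R]
    [SymmetricCategory R] [∀ A B : R, PartialOrder (A ⟶ B)] : Prop where
  comp_mono : ∀ {A B D : R} {f f' : A ⟶ B} {g g' : B ⟶ D}, f ≤ f' → g ≤ g' → f ≫ g ≤ f' ≫ g'
  tensor_mono : ∀ {A B A' B' : R} {f f' : A ⟶ B} {g g' : A' ⟶ B'},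
    f ≤ f' → g ≤ g' → f ⊗ₘ g ≤ f' ⊗ₘ g'

end QRel

/-!
A formula of the internal language defines a subobject, and the operations used here (equality,
the order, implication, universal quantification) are read off from the subobject classifier and the
power objects. Hence for every definable family the elements below all its upper bounds form an
element of `Ω ^ Q`, and the join of that element is the join of the family. In particular
`φ : I ⟶ Q` has joins along the fibres of any `p : I ⟶ X`, which gives identities, graphs and
composites of relations. Residuals, themselves joins of this kind, make `⊗` distribute over all
joins that exist, not only over those of elements of `Ω ^ Q`.

A join is determined by the elements above it, so an equation between relations is proved by
comparing upper bounds on generalized elements. The graphs `f_∘` form a functor that turns `f × g`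
into `f_∘ ⊗ g_∘`, and composing with the graph of an isomorphism is a substitution; therefore
coherence in the category of relations is inherited from `C`, and naturality reduces to the laws
of the monoid `Q`. Commutativity is what makes `⊗` of relations functorial, and composites and
tensors of algebraic relations algebraic.
-/

namespace QRel

section Truth

variable {C : Type u} [Category.{v} C]

theorem subobject_ext {X : C} {U V : Subobject X}
    (h : ∀ ⦃Z : C⦄ (z : Z ⟶ X), U.Factors z ↔ V.Factors z) : U = V :=
  le_antisymm (Subobject.le_of_factors ((h _).1 U.factors_self))
    (Subobject.le_of_factors ((h _).2 V.factors_self))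

variable [HasSubobjectClassifier C]

theorem mk_truth_factors_iff {X : C} (φ : X ⟶ HasSubobjectClassifier.Ω C) :
    (Subobject.mk (HasSubobjectClassifier.truth C)).Factors φ ↔
      φ = Subobject.Classifier.χ₀ _ X ≫ HasSubobjectClassifier.truth C := by
  rw [Subobject.mk_factors_iff]
  refine ⟨?_, fun h => ⟨_, h.symm⟩⟩
  rintro ⟨l, rfl⟩
  exact congrArg (· ≫ HasSubobjectClassifier.truth C) (Subsingleton.elim _ _)

variable [HasPullbacks C]

theorem mk_truth_factors_comp_χ_iff {X Z : C} (U : Subobject X) (z : Z ⟶ X) :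
    (Subobject.mk (HasSubobjectClassifier.truth C)).Factors
      (z ≫ HasSubobjectClassifier.χ U.arrow) ↔ U.Factors z := by
  have hU : (Subobject.pullback (HasSubobjectClassifier.χ U.arrow)).obj
      (Subobject.mk (HasSubobjectClassifier.truth C)) = U :=
    (Subobject.Classifier.pullback_χ_obj_mk_truth _ U.arrow).trans U.mk_arrow
  rw [← pullback_factors_iff, hU]

theorem truth_ext {X : C} {φ ψ : X ⟶ HasSubobjectClassifier.Ω C}
    (h : ∀ ⦃Z : C⦄ (z : Z ⟶ X), (Subobject.mk (HasSubobjectClassifier.truth C)).Factors (z ≫ φ) ↔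
      (Subobject.mk (HasSubobjectClassifier.truth C)).Factors (z ≫ ψ)) : φ = ψ := by
  refine (Subobject.Classifier.representableBy _).homEquiv.injective (subobject_ext fun Z z => ?_)
  exact (pullback_factors_iff ..).trans ((h z).trans
    (pullback_factors_iff ..).symm)

end Truth

section Power

variable {C : Type u} [Category.{v} C] [CartesianMonoidalCategory C] [MonoidalClosed C]
  [HasSubobjectClassifier C]

theorem mem_comp_iff {A X Z : C} (a : Z ⟶ A) (x : Z ⟶ X) (S : X ⟶ power A) :
    Mem a (x ≫ S) ↔ (Subobject.mk (HasSubobjectClassifier.truth C)).Factors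
      (lift a x ≫ MonoidalClosed.uncurry S) := by
  rw [mk_truth_factors_iff, Mem, MonoidalClosed.uncurry_eq, lift_whiskerLeft_assoc]

theorem power_ext [HasPullbacks C] {A X : C} {S T : X ⟶ power A}
    (h : ∀ ⦃Z : C⦄ (x : Z ⟶ X) (a : Z ⟶ A), Mem a (x ≫ S) ↔ Mem a (x ≫ T)) : S = T := by
  refine MonoidalClosed.uncurry_injective (truth_ext fun Z z => ?_)
  simpa only [mem_comp_iff, lift_comp_fst_snd] using h (z ≫ snd A X) (z ≫ fst A X)

end Power

/-- A predicate on the generalized elements of `X` is definable if it is membership in a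
subobject of `X`, the interpretation of a formula of the internal language. -/
def Definable {C : Type u} [Category.{v} C] {X : C} (P : ∀ ⦃Z : C⦄, (Z ⟶ X) → Prop) : Prop :=
  ∃ U : Subobject X, ∀ ⦃Z : C⦄ (z : Z ⟶ X), P z ↔ U.Factors z

namespace Definable

variable {C : Type u} [Category.{v} C] {X : C} {P P' : ∀ ⦃Z : C⦄, (Z ⟶ X) → Prop}

theorem congr (hP : Definable P) (h : ∀ ⦃Z : C⦄ (z : Z ⟶ X), P' z ↔ P z) : Definable P' := by
  obtain ⟨U, hU⟩ := hP
  exact ⟨U, fun Z z => (h z).trans (hU z)⟩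

theorem eq [HasEqualizers C] {Y : C} (f g : X ⟶ Y) : Definable fun _ z => z ≫ f = z ≫ g :=
  ⟨equalizerSubobject f g, fun _ z => (equalizerSubobject_factors_iff f g z).symm⟩

section Pullbacks

variable [HasPullbacks C]

theorem comp (hP : Definable P) {Y : C} (f : Y ⟶ X) : Definable fun _ z => P (z ≫ f) := by
  obtain ⟨U, hU⟩ := hP
  exact ⟨(Subobject.pullback f).obj U, fun _ z => (hU _).trans (pullback_factors_iff f U z).symm⟩

theorem imp [HasEqualizers C] [HasSubobjectClassifier C] (hP : Definable P) (hP' : Definable P') :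
    Definable fun Z z => ∀ ⦃W : C⦄ (w : W ⟶ Z), P (w ≫ z) → P' (w ≫ z) := by
  obtain ⟨U, hU⟩ := hP
  obtain ⟨U', hU'⟩ := hP'
  -- `P ⇒ P'` is the equation between the truth values of `P` and `P ∧ P'`
  refine (Definable.eq (HasSubobjectClassifier.χ U.arrow)
    (HasSubobjectClassifier.χ (U ⊓ U').arrow)).congr fun Z z => ?_
  simp only [hU, hU']
  constructor
  · refine fun h => truth_ext fun W w => ?_
    rw [← Category.assoc, ← Category.assoc, mk_truth_factors_comp_χ_iff,
      mk_truth_factors_comp_χ_iff, Subobject.inf_factors]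
    exact ⟨fun hw => ⟨hw, h w hw⟩, And.left⟩
  · intro h W w hw
    rw [← mk_truth_factors_comp_χ_iff, Category.assoc, h, ← Category.assoc,
      mk_truth_factors_comp_χ_iff, Subobject.inf_factors] at hw
    exact hw.2

end Pullbacks

variable [CartesianMonoidalCategory C] [MonoidalClosed C] [HasSubobjectClassifier C]
  [HasPullbacks C]

theorem exists_name {A : C} {P : ∀ ⦃Z : C⦄, (Z ⟶ X ⊗ A) → Prop} (hP : Definable P) :
    ∃ S : X ⟶ power A, ∀ ⦃Z : C⦄ (x : Z ⟶ X) (a : Z ⟶ A), Mem a (x ≫ S) ↔ P (lift x a) := by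
  obtain ⟨U, hU⟩ := hP
  refine ⟨MonoidalClosed.curry (lift (snd A X) (fst A X) ≫ HasSubobjectClassifier.χ U.arrow),
    fun Z x a => ?_⟩
  rw [mem_comp_iff, MonoidalClosed.uncurry_curry, ← Category.assoc, mk_truth_factors_comp_χ_iff,
    hU, comp_lift, lift_snd, lift_fst]

theorem all [HasEqualizers C] {A : C} {P : ∀ ⦃Z : C⦄, (Z ⟶ X ⊗ A) → Prop} (hP : Definable P) :
    Definable fun Z z => ∀ ⦃W : C⦄ (w : W ⟶ Z) (a : W ⟶ A), P (lift (w ≫ z) a) := by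
  obtain ⟨S, hS⟩ := hP.exists_name
  obtain ⟨T, hT⟩ := (Definable.eq (𝟙 (X ⊗ A)) (𝟙 (X ⊗ A))).exists_name
  refine (Definable.eq S T).congr fun Z z => ⟨fun h => power_ext fun W w a => ?_,
    fun h W w a => ?_⟩
  · rw [← Category.assoc, ← Category.assoc, hS, hT]
    exact iff_of_true (h w a) rfl
  · rw [← hS, Category.assoc, h, ← Category.assoc, hT]

end Definable

section Families

variable {C : Type u} [Category.{v} C]

/-- A family `P` as in `InternalPoset.IsJoin` is stable if membership is preserved by change of
stage, as it is for every family described by a formula of the internal language. -/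
def IsStable {X A : C} (P : ∀ ⦃Z : C⦄, (Z ⟶ X) → (Z ⟶ A) → Prop) : Prop :=
  ∀ ⦃Z W : C⦄ (w : W ⟶ Z) ⦃x : Z ⟶ X⦄ ⦃b : Z ⟶ A⦄, P x b → P (w ≫ x) (w ≫ b)

/-- The family `{φ i | p i = x}`, indexed by `x` in `X`. -/
def fiberImage {I X A : C} (p : I ⟶ X) (φ : I ⟶ A) ⦃Z : C⦄ (x : Z ⟶ X) (b : Z ⟶ A) : Prop :=
  ∃ i : Z ⟶ I, i ≫ p = x ∧ b = i ≫ φ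

theorem isStable_fiberImage {I X A : C} (p : I ⟶ X) (φ : I ⟶ A) : IsStable (fiberImage p φ) := by
  rintro Z W w _ _ ⟨i, rfl, rfl⟩
  exact ⟨w ≫ i, Category.assoc .., (Category.assoc ..).symm⟩

end Families

namespace InternalPoset

variable {C : Type u} [Category.{v} C] [CartesianMonoidalCategory C] {Q : InternalPoset C}

theorem LE.comp {X Y : C} {a b : X ⟶ Q.obj} (h : Q.LE a b) (f : Y ⟶ X) :
    Q.LE (f ≫ a) (f ≫ b) := by
  rw [LE, ← comp_lift]
  exact Subobject.factors_of_factors_right f h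

theorem LE.trans {X : C} {a b c : X ⟶ Q.obj} (h : Q.LE a b) (h' : Q.LE b c) : Q.LE a c :=
  Q.trans a b c h h'

theorem LE.antisymm {X : C} {a b : X ⟶ Q.obj} (h : Q.LE a b) (h' : Q.LE b a) : a = b :=
  Q.antisymm a b h h'

theorem le_refl {X : C} (a : X ⟶ Q.obj) : Q.LE a a :=
  Q.refl a

theorem eq_of_forall_le_iff {X : C} {a b : X ⟶ Q.obj}
    (h : ∀ q : X ⟶ Q.obj, Q.LE a q ↔ Q.LE b q) : a = b :=
  ((h b).2 (le_refl b)).antisymm ((h a).1 (le_refl a))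

theorem forall_comp_le_comp_iff {X : C} {a b : X ⟶ Q.obj} :
    (∀ ⦃Z : C⦄ (z : Z ⟶ X), Q.LE (z ≫ a) (z ≫ b)) ↔ Q.LE a b :=
  ⟨fun h => by simpa only [Category.id_comp] using h (𝟙 X), fun h _ z => h.comp z⟩

theorem definable_le [HasPullbacks C] {X : C} (a b : X ⟶ Q.obj) :
    Definable fun _ z => Q.LE (z ≫ a) (z ≫ b) :=
  ⟨(Subobject.pullback (lift a b)).obj Q.rel, fun _ z => by
    rw [pullback_factors_iff, comp_lift]
    rfl⟩

/-- `q x` is an upper bound of the set `{b | P x b}`, for a family `P` as in `IsJoin`. -/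
def IsUpperBound (Q : InternalPoset C) {X Y : C} (P : ∀ ⦃Z : C⦄, (Z ⟶ X) → (Z ⟶ Q.obj) → Prop)
    (x : Y ⟶ X) (q : Y ⟶ Q.obj) : Prop :=
  ∀ ⦃Z : C⦄ (z : Z ⟶ Y) (b : Z ⟶ Q.obj), P (z ≫ x) b → Q.LE b (z ≫ q)

namespace IsJoin

variable {X : C} {P P' : ∀ ⦃Z : C⦄, (Z ⟶ X) → (Z ⟶ Q.obj) → Prop} {s t : X ⟶ Q.obj}

theorem congr (h : Q.IsJoin P s) (hP : ∀ ⦃Z : C⦄ (x : Z ⟶ X) (b : Z ⟶ Q.obj), P' x b ↔ P x b) :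
    Q.IsJoin P' s := by
  simpa only [IsJoin, hP] using h

theorem comp (h : Q.IsJoin P s) {Y : C} (f : Y ⟶ X) :
    Q.IsJoin (fun _ y b => P (y ≫ f) b) (f ≫ s) := by
  intro Z y q
  simpa only [Category.assoc] using h (y ≫ f) q

theorem le_iff (h : Q.IsJoin P s) (q : X ⟶ Q.obj) :
    Q.LE s q ↔ ∀ ⦃Z : C⦄ (z : Z ⟶ X) (b : Z ⟶ Q.obj), P z b → Q.LE b (z ≫ q) := by
  simpa only [Category.id_comp, Category.comp_id] using h (𝟙 X) q

theorem le (h : Q.IsJoin P s) {b : X ⟶ Q.obj} (hb : P (𝟙 X) b) : Q.LE b s := by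
  simpa only [Category.id_comp] using (h.le_iff s).1 (le_refl s) (𝟙 X) b hb

theorem unique (h : Q.IsJoin P s) (h' : Q.IsJoin P t) : s = t :=
  eq_of_forall_le_iff fun q => (h.le_iff q).trans (h'.le_iff q).symm

theorem singleton (a : X ⟶ Q.obj) : Q.IsJoin (fun _ x b => b = x ≫ a) a := by
  intro Y x q
  rw [← forall_comp_le_comp_iff]
  simp only [forall_eq, Category.assoc]

end IsJoin

end InternalPoset

namespace InternalQuantale

open InternalPoset

section Joins

variable {C : Type u} [Category.{v} C] [CartesianMonoidalCategory C] [MonoidalClosed C]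
  [HasSubobjectClassifier C] [HasFiniteLimits C] (Q : InternalQuantale C)

theorem exists_isJoin_of_definable {X : C} {P : ∀ ⦃Z : C⦄, (Z ⟶ X) → (Z ⟶ Q.obj) → Prop}
    (hP : IsStable P) (hU : Definable fun (Z : C) (z : Z ⟶ X ⊗ Q.obj) =>
      Q.IsUpperBound P (z ≫ fst X Q.obj) (z ≫ snd X Q.obj)) :
    ∃ s : X ⟶ Q.obj, Q.IsJoin P s := by
  -- the elements below all upper bounds form an element of `Ω ^ Q`, whose join is the one of `P`
  have hL := ((hU.comp (lift (fst (X ⊗ Q.obj) Q.obj ≫ fst _ _) (snd _ _))).imp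
    (definable_le (fst (X ⊗ Q.obj) Q.obj ≫ snd _ _) (snd _ _))).all
  obtain ⟨S, hS⟩ := hL.exists_name
  refine ⟨S ≫ Q.sup, fun Y x q => (Q.isJoin_sup S x q).trans ⟨fun h Z z b hb => ?_,
    fun h Z z b hb => ?_⟩⟩
  · refine h z b ((hS _ _).2 fun W w q' V v' hu => ?_)
    simpa using hu (𝟙 V) (v' ≫ w ≫ b) (by simpa using hP v' (hP w hb))
  · simpa using (hS _ _).1 hb (𝟙 Z) (z ≫ q) (𝟙 Z) fun W w c hc => by
      simpa using h (w ≫ z) c (by simpa using hc)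

theorem exists_isJoin_fiberImage {I X : C} (p : I ⟶ X) (φ : I ⟶ Q.obj) :
    ∃ s : X ⟶ Q.obj, Q.IsJoin (fiberImage p φ) s := by
  refine Q.exists_isJoin_of_definable (isStable_fiberImage p φ)
    (((Definable.eq (snd (X ⊗ Q.obj) I ≫ p) (fst _ _ ≫ fst _ _)).imp
      (definable_le (snd _ _ ≫ φ) (fst _ _ ≫ snd _ _))).all.congr fun Z z => ?_)
  simp only [lift_fst_assoc, lift_snd_assoc, Category.assoc]
  constructor
  · rintro h W w i V v hi
    simpa using h (v ≫ w) _ ⟨v ≫ i, by simpa using hi, rfl⟩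
  · rintro h W w _ ⟨i, hi, rfl⟩
    simpa using h w i (𝟙 W) (by simpa using hi)

/-- The join of `φ` along the fibres of `p`: the morphism `x ↦ ⋁ {φ i | p i = x}`. -/
noncomputable def joinAlong {I X : C} (p : I ⟶ X) (φ : I ⟶ Q.obj) : X ⟶ Q.obj :=
  (Q.exists_isJoin_fiberImage p φ).choose

theorem isJoin_joinAlong {I X : C} (p : I ⟶ X) (φ : I ⟶ Q.obj) :
    Q.IsJoin (fiberImage p φ) (Q.joinAlong p φ) :=
  (Q.exists_isJoin_fiberImage p φ).choose_spec

end Joins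

section Multiplication

variable {C : Type u} [Category.{v} C] [CartesianMonoidalCategory C] [MonoidalClosed C]
  [HasSubobjectClassifier C] {Q : InternalQuantale C}

variable (Q) in
/-- A morphism `φ : X × Q ⟶ Q` preserves joins of elements of `Ω ^ Q` in its second argument. -/
def PreservesSup {X : C} (φ : X ⊗ Q.obj ⟶ Q.obj) : Prop :=
  ∀ ⦃Y : C⦄ (x : Y ⟶ X) (S : Y ⟶ power Q.obj),
    Q.IsJoin (fun _ y c => ∃ b, Mem b (y ≫ S) ∧ c = lift (y ≫ x) b ≫ φ)
      (lift x (S ≫ Q.sup) ≫ φ)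

variable (Q) in
theorem preservesSup_mul_left : Q.PreservesSup (fst Q.obj Q.obj * snd Q.obj Q.obj) := by
  intro Y x S
  simpa only [MonObj.comp_mul, lift_fst, lift_snd] using Q.mul_sup x S

variable (Q) in
theorem preservesSup_mul_right : Q.PreservesSup (snd Q.obj Q.obj * fst Q.obj Q.obj) := by
  intro Y x S
  simpa only [MonObj.comp_mul, lift_fst, lift_snd] using Q.sup_mul S x

section Pullbacks

variable [HasPullbacks C]

theorem exists_lowerSet {X : C} (b : X ⟶ Q.obj) :
    ∃ S : X ⟶ power Q.obj, S ≫ Q.sup = b ∧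
      ∀ ⦃Z : C⦄ (x : Z ⟶ X) (a : Z ⟶ Q.obj), Mem a (x ≫ S) ↔ Q.LE a (x ≫ b) := by
  obtain ⟨S, hS⟩ := (definable_le (snd X Q.obj) (fst X Q.obj ≫ b)).exists_name
  replace hS : ∀ ⦃Z : C⦄ (x : Z ⟶ X) (a : Z ⟶ Q.obj), Mem a (x ≫ S) ↔ Q.LE a (x ≫ b) :=
    fun Z x a => by simpa using hS x a
  refine ⟨S, eq_of_forall_le_iff fun q => ((Q.isJoin_sup S).le_iff q).trans ?_, hS⟩
  simp only [hS]
  exact ⟨fun h => by simpa using h (𝟙 X) b (by simpa using le_refl b),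
    fun h Z z a ha => ha.trans (h.comp z)⟩

namespace PreservesSup

variable {X Y : C} {φ : X ⊗ Q.obj ⟶ Q.obj}

theorem monotone (hφ : Q.PreservesSup φ) (x : Y ⟶ X) {a b : Y ⟶ Q.obj} (h : Q.LE a b) :
    Q.LE (lift x a ≫ φ) (lift x b ≫ φ) := by
  obtain ⟨S, rfl, hS⟩ := exists_lowerSet b
  exact (hφ x S).le ⟨a, (hS _ _).2 (by simpa using h), by simp⟩

theorem exists_residual (hφ : Q.PreservesSup φ) (x : Y ⟶ X) (q : Y ⟶ Q.obj) :
    ∃ r : Y ⟶ Q.obj, ∀ ⦃Z : C⦄ (z : Z ⟶ Y) (b : Z ⟶ Q.obj),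
      Q.LE b (z ≫ r) ↔ Q.LE (lift (z ≫ x) b ≫ φ) (z ≫ q) := by
  obtain ⟨S, hS⟩ := (definable_le (lift (fst Y Q.obj ≫ x) (snd Y Q.obj) ≫ φ)
    (fst Y Q.obj ≫ q)).exists_name
  replace hS : ∀ ⦃Z : C⦄ (z : Z ⟶ Y) (b : Z ⟶ Q.obj),
      Mem b (z ≫ S) ↔ Q.LE (lift (z ≫ x) b ≫ φ) (z ≫ q) := fun Z z b => by
    simpa [comp_lift_assoc] using hS z b
  refine ⟨S ≫ Q.sup, fun Z z b => ⟨fun h => (hφ.monotone _ h).trans ?_, fun h => ?_⟩⟩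
  · rw [← comp_lift_assoc, hφ x S z]
    rintro W w _ ⟨c, hc, rfl⟩
    simpa using (hS _ _).1 hc
  · exact ((Q.isJoin_sup S).comp z).le (by simpa using (hS _ _).2 h)

theorem isJoin (hφ : Q.PreservesSup φ) (x : Y ⟶ X)
    {P : ∀ ⦃Z : C⦄, (Z ⟶ Y) → (Z ⟶ Q.obj) → Prop} {s : Y ⟶ Q.obj} (h : Q.IsJoin P s) :
    Q.IsJoin (fun _ y c => ∃ b, P y b ∧ c = lift (y ≫ x) b ≫ φ) (lift x s ≫ φ) := by
  intro Z z q
  obtain ⟨r, hr⟩ := hφ.exists_residual (z ≫ x) q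
  have hs : Q.LE (z ≫ s) r ↔ Q.LE (z ≫ lift x s ≫ φ) q := by
    simpa [comp_lift_assoc] using hr (𝟙 Z) (z ≫ s)
  rw [← hs, h]
  simp only [hr, Category.assoc]
  exact ⟨by rintro H W w _ ⟨b, hb, rfl⟩; exact H w b hb, fun H W w b hb => H w _ ⟨b, hb, rfl⟩⟩

end PreservesSup

theorem mul_le_mul {X : C} {a b c d : X ⟶ Q.obj} (h : Q.LE a b) (h' : Q.LE c d) :
    Q.LE (a * c) (b * d) := by
  have hleft := (preservesSup_mul_left Q).monotone b h'
  have hright := (preservesSup_mul_right Q).monotone c h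
  simp only [MonObj.comp_mul, lift_fst, lift_snd] at hleft hright
  exact hright.trans hleft

variable {X : C} {P P' : ∀ ⦃Z : C⦄, (Z ⟶ X) → (Z ⟶ Q.obj) → Prop} {s s' : X ⟶ Q.obj}

theorem isJoin_mul_left (a : X ⟶ Q.obj) (h : Q.IsJoin P s) :
    Q.IsJoin (fun _ x c => ∃ b, P x b ∧ c = (x ≫ a) * b) (a * s) := by
  simpa only [MonObj.comp_mul, lift_fst, lift_snd] using (preservesSup_mul_left Q).isJoin a h

theorem isJoin_mul_right (h : Q.IsJoin P s) (a : X ⟶ Q.obj) :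
    Q.IsJoin (fun _ x c => ∃ b, P x b ∧ c = b * (x ≫ a)) (s * a) := by
  simpa only [MonObj.comp_mul, lift_fst, lift_snd] using (preservesSup_mul_right Q).isJoin a h

theorem mul_le_iff_of_isJoin_right (h : Q.IsJoin P s) (a q : X ⟶ Q.obj) :
    Q.LE (a * s) q ↔
      ∀ ⦃Z : C⦄ (z : Z ⟶ X) (b : Z ⟶ Q.obj), P z b → Q.LE ((z ≫ a) * b) (z ≫ q) := by
  rw [(isJoin_mul_left a h).le_iff]
  exact ⟨fun H Z z b hb => H z _ ⟨b, hb, rfl⟩, by rintro H Z z _ ⟨b, hb, rfl⟩; exact H z b hb⟩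

theorem mul_le_iff_of_isJoin_left (h : Q.IsJoin P s) (a q : X ⟶ Q.obj) :
    Q.LE (s * a) q ↔
      ∀ ⦃Z : C⦄ (z : Z ⟶ X) (b : Z ⟶ Q.obj), P z b → Q.LE (b * (z ≫ a)) (z ≫ q) := by
  rw [(isJoin_mul_right h a).le_iff]
  exact ⟨fun H Z z b hb => H z _ ⟨b, hb, rfl⟩, by rintro H Z z _ ⟨b, hb, rfl⟩; exact H z b hb⟩

theorem isJoin_mul (hP : IsStable P) (h : Q.IsJoin P s) (h' : Q.IsJoin P' s') :
    Q.IsJoin (fun _ x c => ∃ b b', P x b ∧ P' x b' ∧ c = b * b') (s * s') := by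
  intro Y y q
  rw [MonObj.comp_mul, mul_le_iff_of_isJoin_left (h.comp y)]
  constructor
  · rintro H Z z _ ⟨b, b', hb, hb', rfl⟩
    have := (mul_le_iff_of_isJoin_right ((h'.comp y).comp z) b _).1 (H z b hb) (𝟙 Z) b'
    simpa using this (by simpa using hb')
  · intro H Z z b hb
    rw [mul_le_iff_of_isJoin_right ((h'.comp y).comp z)]
    intro W w b' hb'
    simpa using H (w ≫ z) _ ⟨w ≫ b, b', by simpa using hP w hb, by simpa using hb', rfl⟩

theorem isJoin_prod {n : ℕ} {P : Fin n → ∀ ⦃Z : C⦄, (Z ⟶ X) → (Z ⟶ Q.obj) → Prop}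
    {s : Fin n → (X ⟶ Q.obj)} (hP : ∀ i, IsStable (P i)) (h : ∀ i, Q.IsJoin (P i) (s i)) :
    Q.IsJoin (fun Z x c => ∃ b : Fin n → (Z ⟶ Q.obj), (∀ i, P i x (b i)) ∧
      c = (List.ofFn b).prod) (List.ofFn s).prod := by
  induction n with
  | zero =>
    simpa [MonObj.comp_one] using IsJoin.singleton (Q := Q.toInternalPoset) (1 : X ⟶ Q.obj)
  | succ n ih =>
    rw [List.ofFn_succ, List.prod_cons]
    refine (isJoin_mul (hP 0) (h 0) (ih (fun i => hP i.succ) fun i => h i.succ)).congr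
      fun Z x c => ?_
    simp only [Fin.exists_fin_succ_pi, Fin.forall_fin_succ, Fin.cons_zero, Fin.cons_succ,
      List.ofFn_succ, List.prod_cons]
    constructor
    · rintro ⟨b, b', ⟨hb, hb'⟩, rfl⟩
      exact ⟨b, _, hb, ⟨b', hb', rfl⟩, rfl⟩
    · rintro ⟨b, _, hb, ⟨b', hb', rfl⟩, rfl⟩
      exact ⟨b, b', ⟨hb, hb'⟩, rfl⟩

end Pullbacks

namespace IsCommutative

variable {X : C}

theorem mul_mul_mul_comm (hQ : Q.IsCommutative) (a b c d : X ⟶ Q.obj) :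
    a * b * (c * d) = a * c * (b * d) := by
  rw [_root_.mul_assoc, _root_.mul_assoc, ← _root_.mul_assoc b, hQ b c, _root_.mul_assoc]

theorem prod_mul (hQ : Q.IsCommutative) {n : ℕ} (s t : Fin n → (X ⟶ Q.obj)) :
    (List.ofFn fun i => s i * t i).prod = (List.ofFn s).prod * (List.ofFn t).prod := by
  induction n with
  | zero => simp only [List.ofFn_zero, List.prod_nil, _root_.mul_one]
  | succ n ih =>
    simp only [List.ofFn_succ, List.prod_cons, ih, hQ.mul_mul_mul_comm]

end IsCommutative

end Multiplication

end InternalQuantale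

namespace Rel

open InternalPoset InternalQuantale

section Val

variable {C : Type u} [Category.{v} C] [CartesianMonoidalCategory C] [MonoidalClosed C]
  [HasSubobjectClassifier C] {Q : InternalQuantale C} {A B D A' B' X : C}

theorem comp_val (R : Rel Q A B) {Y : C} (f : Y ⟶ X) (a : X ⟶ A) (b : X ⟶ B) :
    f ≫ val R a b = val R (f ≫ a) (f ≫ b) := by
  rw [val, val, comp_lift_assoc]

theorem val_fst_snd (R : Rel Q A B) : val R (fst A B) (snd A B) = R := by
  rw [val, lift_fst_snd, Category.id_comp]

theorem ext_val {R S : Rel Q A B}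
    (h : ∀ ⦃X : C⦄ (a : X ⟶ A) (b : X ⟶ B), val R a b = val S a b) : R = S := by
  rw [← val_fst_snd R, h, val_fst_snd]

theorem val_tensor (R : Rel Q A B) (R' : Rel Q A' B') (a : X ⟶ A ⊗ A') (b : X ⟶ B ⊗ B') :
    val (tensor R R') a b =
      val R (a ≫ fst A A') (b ≫ fst B B') * val R' (a ≫ snd A A') (b ≫ snd B B') := by
  rw [val, tensor]
  simp only [MonObj.comp_mul, comp_val, lift_fst_assoc, lift_snd_assoc]

theorem isStable_val_comp (R : Rel Q A B) (S : Rel Q B D) (a : X ⟶ A) (d : X ⟶ D) :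
    IsStable fun Z (z : Z ⟶ X) t => ∃ b : Z ⟶ B, t = val R (z ≫ a) b * val S b (z ≫ d) := by
  rintro Z W w z _ ⟨b, rfl⟩
  exact ⟨w ≫ b, by simp only [MonObj.comp_mul, comp_val, Category.assoc]⟩

theorem isStable_val_graph (f : A ⟶ B) (a : X ⟶ A) (b : X ⟶ B) :
    IsStable fun Z (z : Z ⟶ X) (t : Z ⟶ Q.obj) => z ≫ a ≫ f = z ≫ b ∧ t = 1 := by
  rintro Z W w z _ ⟨h, rfl⟩
  exact ⟨by rw [Category.assoc, h, Category.assoc], MonObj.comp_one _⟩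

namespace Sub

variable {R S T : Rel Q A B}

theorem refl (R : Rel Q A B) : Sub R R :=
  fun _ _ _ => le_refl _

theorem trans (h : Sub R S) (h' : Sub S T) : Sub R T :=
  fun _ a b => (h a b).trans (h' a b)

theorem antisymm (h : Sub R S) (h' : Sub S R) : R = S :=
  ext_val fun _ a b => (h a b).antisymm (h' a b)

end Sub

theorem tensor_mono [HasPullbacks C] {R S : Rel Q A B} {R' S' : Rel Q A' B'} (h : Sub R S)
    (h' : Sub R' S') : Sub (tensor R R') (tensor S S') := by
  intro X a b
  rw [val_tensor, val_tensor]
  exact mul_le_mul (h _ _) (h' _ _)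

end Val

variable {C : Type u} [Category.{v} C] [HasFiniteLimits C] [CartesianMonoidalCategory C]
  [MonoidalClosed C] [HasSubobjectClassifier C] {Q : InternalQuantale C} {A B D A' B' D' X : C}

/-- The composite of `Q`-relations, in diagrammatic order: for `b` in the fibre of `A × D × B` over
`(a, d)`, the join of `R(a, b) ⊗ S(b, d)`. -/
noncomputable def comp (R : Rel Q A B) (S : Rel Q B D) : Rel Q A D :=
  Q.joinAlong (fst (A ⊗ D) B)
    (val R (fst (A ⊗ D) B ≫ fst A D) (snd (A ⊗ D) B) *
      val S (snd (A ⊗ D) B) (fst (A ⊗ D) B ≫ snd A D))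

theorem isComposite_comp (R : Rel Q A B) (S : Rel Q B D) : IsComposite R S (comp R S) := by
  refine (Q.isJoin_joinAlong _ _).congr fun Z x t => ?_
  simp only [fiberImage, MonObj.comp_mul, comp_val]
  constructor
  · rintro ⟨b, rfl⟩
    exact ⟨lift x b, by simp⟩
  · rintro ⟨i, rfl, rfl⟩
    exact ⟨i ≫ snd _ _, by simp only [Category.assoc]⟩

variable (Q) in
/-- The graph `f_∘` of a morphism: the image of the constant `k` along `(𝟙, f) : A ⟶ A × B`. -/
noncomputable def graph (f : A ⟶ B) : Rel Q A B :=
  Q.joinAlong (lift (𝟙 A) f) 1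

variable (Q) in
theorem isGraph_graph (f : A ⟶ B) : IsGraph f (graph Q f) := by
  refine (Q.isJoin_joinAlong _ _).congr fun Z x t => ?_
  simp only [fiberImage, MonObj.comp_one]
  constructor
  · rintro ⟨h, rfl⟩
    exact ⟨x ≫ fst A B, by ext <;> simp [← h], rfl⟩
  · rintro ⟨i, rfl, rfl⟩
    simp

variable (Q A) in
theorem isIdentity_graph_id : IsIdentity (graph Q (𝟙 A)) := by
  simpa only [IsGraph, IsIdentity, Category.comp_id] using isGraph_graph Q (𝟙 A)

section Comp

theorem isJoin_val_comp (R : Rel Q A B) (S : Rel Q B D) (a : X ⟶ A) (d : X ⟶ D) :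
    Q.IsJoin (fun Z z t => ∃ b : Z ⟶ B, t = val R (z ≫ a) b * val S b (z ≫ d))
      (val (comp R S) a d) := by
  have h := (isComposite_comp R S).comp (lift a d)
  simp only [Category.assoc, lift_fst, lift_snd] at h
  exact h

theorem val_comp_le_iff (R : Rel Q A B) (S : Rel Q B D) (a : X ⟶ A) (d : X ⟶ D)
    (q : X ⟶ Q.obj) :
    Q.LE (val (comp R S) a d) q ↔ ∀ ⦃Z : C⦄ (z : Z ⟶ X) (b : Z ⟶ B),
      Q.LE (val R (z ≫ a) b * val S b (z ≫ d)) (z ≫ q) := by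
  rw [(isJoin_val_comp R S a d).le_iff]
  exact ⟨fun H Z z b => H z _ ⟨b, rfl⟩, by rintro H Z z _ ⟨b, rfl⟩; exact H z b⟩

theorem mul_val_comp_le_iff (R : Rel Q A B) (S : Rel Q B D) (a : X ⟶ A) (d : X ⟶ D)
    (p q : X ⟶ Q.obj) :
    Q.LE (p * val (comp R S) a d) q ↔ ∀ ⦃Z : C⦄ (z : Z ⟶ X) (b : Z ⟶ B),
      Q.LE ((z ≫ p) * (val R (z ≫ a) b * val S b (z ≫ d))) (z ≫ q) := by
  rw [mul_le_iff_of_isJoin_right (isJoin_val_comp R S a d)]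
  exact ⟨fun H Z z b => H z _ ⟨b, rfl⟩, by rintro H Z z _ ⟨b, rfl⟩; exact H z b⟩

theorem val_comp_mul_le_iff (R : Rel Q A B) (S : Rel Q B D) (a : X ⟶ A) (d : X ⟶ D)
    (p q : X ⟶ Q.obj) :
    Q.LE (val (comp R S) a d * p) q ↔ ∀ ⦃Z : C⦄ (z : Z ⟶ X) (b : Z ⟶ B),
      Q.LE (val R (z ≫ a) b * val S b (z ≫ d) * (z ≫ p)) (z ≫ q) := by
  rw [mul_le_iff_of_isJoin_left (isJoin_val_comp R S a d)]
  exact ⟨fun H Z z b => H z _ ⟨b, rfl⟩, by rintro H Z z _ ⟨b, rfl⟩; exact H z b⟩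

theorem mul_le_val_comp (R : Rel Q A B) (S : Rel Q B D) (a : X ⟶ A) (b : X ⟶ B) (d : X ⟶ D) :
    Q.LE (val R a b * val S b d) (val (comp R S) a d) :=
  (isJoin_val_comp R S a d).le ⟨b, by simp only [Category.id_comp]⟩

theorem comp_mono {R R' : Rel Q A B} {S S' : Rel Q B D} (h : Sub R R') (h' : Sub S S') :
    Sub (comp R S) (comp R' S') := by
  intro X a d
  rw [val_comp_le_iff]
  intro Z z b
  rw [comp_val]
  exact (mul_le_mul (h _ _) (h' _ _)).trans (mul_le_val_comp R' S' _ _ _)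

theorem comp_assoc {E : C} (R : Rel Q A B) (S : Rel Q B D) (T : Rel Q D E) :
    comp (comp R S) T = comp R (comp S T) := by
  refine ext_val fun X a e => eq_of_forall_le_iff fun q => ?_
  simp only [val_comp_le_iff, mul_val_comp_le_iff, val_comp_mul_le_iff, comp_val]
  constructor
  · intro H Z z b W w d
    simpa [_root_.mul_assoc] using H (w ≫ z) d (𝟙 W) (w ≫ b)
  · intro H Z z d W w b
    simpa [_root_.mul_assoc] using H (w ≫ z) b (𝟙 W) (w ≫ d)

theorem tensor_comp_tensor (hQ : Q.IsCommutative) (R : Rel Q A B) (S : Rel Q B D) (R' : Rel Q A' B')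
    (S' : Rel Q B' D') :
    comp (tensor R R') (tensor S S') = tensor (comp R S) (comp R' S') := by
  refine ext_val fun X a d => (isJoin_val_comp _ _ a d).unique ?_
  rw [val_tensor]
  refine (isJoin_mul (isStable_val_comp ..) (isJoin_val_comp ..) (isJoin_val_comp ..)).congr
    fun Z z t => ?_
  simp only [val_tensor, hQ.mul_mul_mul_comm, Category.assoc]
  constructor
  · rintro ⟨b, rfl⟩
    exact ⟨_, _, ⟨b ≫ fst _ _, rfl⟩, ⟨b ≫ snd _ _, rfl⟩, rfl⟩
  · rintro ⟨_, _, ⟨b, rfl⟩, ⟨b', rfl⟩, rfl⟩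
    exact ⟨lift b b', by simp only [lift_fst, lift_snd]⟩

end Comp

section Graph

theorem isJoin_val_graph (f : A ⟶ B) (a : X ⟶ A) (b : X ⟶ B) :
    Q.IsJoin (fun _ z t => z ≫ a ≫ f = z ≫ b ∧ t = 1) (val (graph Q f) a b) := by
  have h := (isGraph_graph Q f).comp (lift a b)
  simp only [Category.assoc, lift_fst_assoc, lift_snd] at h
  exact h

theorem mul_val_graph_le_iff (f : A ⟶ B) (a : X ⟶ A) (b : X ⟶ B) (p q : X ⟶ Q.obj) :
    Q.LE (p * val (graph Q f) a b) q ↔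
      ∀ ⦃Z : C⦄ (z : Z ⟶ X), z ≫ a ≫ f = z ≫ b → Q.LE (z ≫ p) (z ≫ q) := by
  rw [mul_le_iff_of_isJoin_right (isJoin_val_graph f a b)]
  constructor
  · intro H Z z h
    simpa only [_root_.mul_one] using H z 1 ⟨h, rfl⟩
  · rintro H Z z _ ⟨h, rfl⟩
    simpa only [_root_.mul_one] using H z h

theorem val_graph_mul_le_iff (f : A ⟶ B) (a : X ⟶ A) (b : X ⟶ B) (p q : X ⟶ Q.obj) :
    Q.LE (val (graph Q f) a b * p) q ↔
      ∀ ⦃Z : C⦄ (z : Z ⟶ X), z ≫ a ≫ f = z ≫ b → Q.LE (z ≫ p) (z ≫ q) := by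
  rw [mul_le_iff_of_isJoin_left (isJoin_val_graph f a b)]
  constructor
  · intro H Z z h
    simpa only [_root_.one_mul] using H z 1 ⟨h, rfl⟩
  · rintro H Z z _ ⟨h, rfl⟩
    simpa only [_root_.one_mul] using H z h

theorem val_graph_eq_one (f : A ⟶ B) {a : X ⟶ A} {b : X ⟶ B} (h : a ≫ f = b) :
    val (graph Q f) a b = 1 := by
  refine (isJoin_val_graph f a b).unique ((IsJoin.singleton 1).congr fun Z z t => ?_)
  simp only [h, true_and, MonObj.comp_one]

theorem val_graph_comp (f : A ⟶ B) (S : Rel Q B D) (a : X ⟶ A) (d : X ⟶ D) :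
    val (comp (graph Q f) S) a d = val S (a ≫ f) d := by
  refine eq_of_forall_le_iff fun q => ?_
  simp only [val_comp_le_iff, val_graph_mul_le_iff, comp_val]
  constructor
  · intro H
    simpa using H (𝟙 X) (a ≫ f) (𝟙 X) (by simp)
  · intro h Z z b W w hb
    simpa [comp_val, ← hb] using h.comp (w ≫ z)

theorem val_comp_graph (R : Rel Q A B) (e : B ≅ D) (a : X ⟶ A) (d : X ⟶ D) :
    val (comp R (graph Q e.hom)) a d = val R a (d ≫ e.inv) := by
  refine eq_of_forall_le_iff fun q => ?_
  simp only [val_comp_le_iff, mul_val_graph_le_iff, comp_val]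
  constructor
  · intro H
    simpa using H (𝟙 X) (d ≫ e.inv) (𝟙 X) (by simp)
  · intro h Z z b W w hb
    have hb : w ≫ b = w ≫ z ≫ d ≫ e.inv := by
      simpa only [Category.assoc, e.hom_inv_id, Category.comp_id] using congr($hb ≫ e.inv)
    simpa [comp_val, hb] using h.comp (w ≫ z)

theorem comp_graph_eq_graph_comp (f : A ⟶ A') (e : B ≅ B') {R : Rel Q A B} {R' : Rel Q A' B'}
    (h : ∀ ⦃X : C⦄ (a : X ⟶ A) (b : X ⟶ B), val R a b = val R' (a ≫ f) (b ≫ e.hom)) :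
    comp R (graph Q e.hom) = comp (graph Q f) R' :=
  ext_val fun X a b => by
    rw [val_comp_graph, val_graph_comp, h, Category.assoc, e.inv_hom_id, Category.comp_id]

theorem id_comp (R : Rel Q A B) : comp (graph Q (𝟙 A)) R = R :=
  ext_val fun _ _ _ => by rw [val_graph_comp, Category.comp_id]

theorem comp_id (R : Rel Q A B) : comp R (graph Q (𝟙 B)) = R :=
  ext_val fun X a b => by
    rw [← Iso.refl_hom, val_comp_graph, Iso.refl_inv, Category.comp_id]

variable (Q) in
theorem graph_comp_graph (f : A ⟶ B) (g : B ⟶ D) :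
    comp (graph Q f) (graph Q g) = graph Q (f ≫ g) := by
  refine ext_val fun X a d => ?_
  rw [val_graph_comp]
  refine (isJoin_val_graph g (a ≫ f) d).unique
    ((isJoin_val_graph (f ≫ g) a d).congr fun Z z t => ?_)
  rw [Category.assoc]

variable (Q) in
theorem tensor_graph (f : A ⟶ B) (g : A' ⟶ B') :
    tensor (graph Q f) (graph Q g) = graph Q (f ⊗ₘ g) := by
  refine ext_val fun X a b => ?_
  rw [val_tensor]
  refine IsJoin.unique
    (isJoin_mul (isStable_val_graph ..) (isJoin_val_graph ..) (isJoin_val_graph ..))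
    ((isJoin_val_graph (f ⊗ₘ g) a b).congr fun Z z t => ?_)
  have hab : z ≫ a ≫ (f ⊗ₘ g) = z ≫ b ↔ z ≫ (a ≫ fst _ _) ≫ f = z ≫ b ≫ fst _ _ ∧
      z ≫ (a ≫ snd _ _) ≫ g = z ≫ b ≫ snd _ _ := by
    simp [CartesianMonoidalCategory.hom_ext_iff]
  rw [hab]
  constructor
  · rintro ⟨_, _, ⟨h, rfl⟩, ⟨h', rfl⟩, rfl⟩
    exact ⟨⟨h, h'⟩, _root_.mul_one 1⟩
  · rintro ⟨⟨h, h'⟩, rfl⟩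
    exact ⟨1, 1, ⟨h, rfl⟩, ⟨h', rfl⟩, (_root_.mul_one 1).symm⟩

end Graph

section Coherence

variable {D' : C}

theorem tensor_comp_graph_associator (R : Rel Q A A') (S : Rel Q B B') (T : Rel Q D D') :
    comp (tensor (tensor R S) T) (graph Q (α_ A' B' D').hom) =
      comp (graph Q (α_ A B D).hom) (tensor R (tensor S T)) := by
  refine comp_graph_eq_graph_comp _ _ fun X a b => ?_
  simp [val_tensor, _root_.mul_assoc]

theorem tensor_comp_graph_leftUnitor (R : Rel Q A B) :
    comp (tensor (graph Q (𝟙 (𝟙_ C))) R) (graph Q (λ_ B).hom) =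
      comp (graph Q (λ_ A).hom) R := by
  refine comp_graph_eq_graph_comp _ _ fun X a b => ?_
  rw [val_tensor, val_graph_eq_one _ (toUnit_unique _ _), _root_.one_mul, leftUnitor_hom,
    leftUnitor_hom]

theorem tensor_comp_graph_rightUnitor (R : Rel Q A B) :
    comp (tensor R (graph Q (𝟙 (𝟙_ C)))) (graph Q (ρ_ B).hom) =
      comp (graph Q (ρ_ A).hom) R := by
  refine comp_graph_eq_graph_comp _ _ fun X a b => ?_
  rw [val_tensor, val_graph_eq_one _ (toUnit_unique _ _), _root_.mul_one, rightUnitor_hom,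
    rightUnitor_hom]

theorem tensor_comp_graph_braiding [BraidedCategory C] (hQ : Q.IsCommutative) (R : Rel Q A A')
    (S : Rel Q B B') :
    comp (tensor R S) (graph Q (β_ A' B').hom) =
      comp (graph Q (β_ A B).hom) (tensor S R) := by
  refine comp_graph_eq_graph_comp _ _ fun X a b => ?_
  rw [val_tensor, val_tensor, hQ]
  simp only [Category.assoc, braiding_hom_fst, braiding_hom_snd]

end Coherence

end Rel

section RelCat

open QRel.Rel

variable {C : Type u} [Category.{v} C] [HasFiniteLimits C] [CartesianMonoidalCategory C]
  [MonoidalClosed C] [HasSubobjectClassifier C]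

/-- The objects of `C`, as objects of the category of `Q`-relations. -/
structure RelCat (Q : InternalQuantale C) where
  carrier : C

namespace RelCat

variable {Q : InternalQuantale C}

noncomputable instance : Category.{v} (RelCat Q) where
  Hom A B := Rel Q A.carrier B.carrier
  id A := graph Q (𝟙 A.carrier)
  comp R S := Rel.comp R S
  id_comp := Rel.id_comp
  comp_id := Rel.comp_id
  assoc := Rel.comp_assoc

variable (Q) in
/-- The functor `f ↦ f_∘`. -/
noncomputable def graphFunctor : C ⥤ RelCat Q where
  obj A := ⟨A⟩
  map f := graph Q f
  map_id _ := rfl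
  map_comp f g := (graph_comp_graph Q f g).symm

noncomputable instance : MonoidalCategoryStruct (RelCat Q) where
  tensorObj A B := ⟨A.carrier ⊗ B.carrier⟩
  tensorUnit := ⟨𝟙_ C⟩
  tensorHom R S := tensor R S
  whiskerLeft A _ _ R := tensor (graph Q (𝟙 A.carrier)) R
  whiskerRight R A := tensor R (graph Q (𝟙 A.carrier))
  associator _ _ _ := (graphFunctor Q).mapIso (α_ _ _ _)
  leftUnitor _ := (graphFunctor Q).mapIso (λ_ _)
  rightUnitor _ := (graphFunctor Q).mapIso (ρ_ _)

theorem graphFunctor_map_whiskerLeft (A : C) {B D : C} (f : B ⟶ D) :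
    (graphFunctor Q).map (A ◁ f) = (graphFunctor Q).obj A ◁ (graphFunctor Q).map f :=
  (congrArg (graph Q) (id_tensorHom A f)).symm.trans (tensor_graph Q (𝟙 A) f).symm

theorem graphFunctor_map_whiskerRight {A B : C} (f : A ⟶ B) (D : C) :
    (graphFunctor Q).map (f ▷ D) = (graphFunctor Q).map f ▷ (graphFunctor Q).obj D :=
  (congrArg (graph Q) (tensorHom_id f D)).symm.trans (tensor_graph Q f (𝟙 D)).symm

variable [hQ : Fact Q.IsCommutative]

noncomputable instance : MonoidalCategory (RelCat Q) :=
  MonoidalCategory.ofTensorHom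
    (id_tensorHom_id := fun A B =>
      (tensor_graph Q _ _).trans (congrArg (graph Q) (id_tensorHom_id A.carrier B.carrier)))
    (id_tensorHom := fun _ _ _ _ => rfl)
    (tensorHom_id := fun _ _ => rfl)
    (tensorHom_comp_tensorHom := fun R R' S S' => tensor_comp_tensor hQ.out R S R' S')
    (associator_naturality := tensor_comp_graph_associator)
    (leftUnitor_naturality := tensor_comp_graph_leftUnitor)
    (rightUnitor_naturality := tensor_comp_graph_rightUnitor)
    (pentagon := fun A B D E => by
      have h := congr((graphFunctor Q).map $(pentagon A.carrier B.carrier D.carrier E.carrier))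
      simp only [Functor.map_comp, graphFunctor_map_whiskerLeft, graphFunctor_map_whiskerRight] at h
      exact h)
    (triangle := fun A B => by
      have h := congr((graphFunctor Q).map $(triangle A.carrier B.carrier))
      simp only [Functor.map_comp, graphFunctor_map_whiskerLeft, graphFunctor_map_whiskerRight] at h
      exact h)

noncomputable instance [BraidedCategory C] : SymmetricCategory (RelCat Q) where
  braiding _ _ := (graphFunctor Q).mapIso (β_ _ _)
  braiding_naturality_right A _ _ R := tensor_comp_graph_braiding hQ.out (graph Q (𝟙 A.carrier)) R
  braiding_naturality_left R A := tensor_comp_graph_braiding hQ.out R (graph Q (𝟙 A.carrier))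
  hexagon_forward A B D := by
    have h := congr((graphFunctor Q).map
      $(BraidedCategory.hexagon_forward A.carrier B.carrier D.carrier))
    simp only [Functor.map_comp, graphFunctor_map_whiskerLeft, graphFunctor_map_whiskerRight] at h
    exact h
  hexagon_reverse A B D := by
    have h := congr((graphFunctor Q).map
      $(BraidedCategory.hexagon_reverse A.carrier B.carrier D.carrier))
    simp only [Functor.map_comp, graphFunctor_map_whiskerLeft, graphFunctor_map_whiskerRight] at h
    exact h
  symmetry A B := by
    have h := congr((graphFunctor Q).map $(SymmetricCategory.symmetry A.carrier B.carrier))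
    simp only [Functor.map_comp] at h
    exact h

end RelCat

end RelCat

section Algebraic

open InternalPoset InternalQuantale QRel.Rel

variable {C : Type u} [Category.{v} C] [HasFiniteLimits C] {V : Variety.{w}}

theorem Alg.comp_app (A : Alg V C) {n : ℕ} (σ : V.Op n) {X Y : C} (f : Y ⟶ X)
    (a : Fin n → (X ⟶ A.carrier)) : f ≫ A.app σ a = A.app σ fun i => f ≫ a i := by
  rw [Alg.app, Alg.app, ← Category.assoc]
  congr 1
  ext
  simp

/-- Homomorphisms of algebras, by their action on generalized elements. -/
def IsHom (A B : Alg V C) (f : A.carrier ⟶ B.carrier) : Prop :=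
  ∀ ⦃n : ℕ⦄ (σ : V.Op n) ⦃X : C⦄ (a : Fin n → (X ⟶ A.carrier)),
    A.app σ a ≫ f = B.app σ fun i => a i ≫ f

theorem isHom_id (A : Alg V C) : IsHom A A (𝟙 A.carrier) := by
  intro n σ X a
  simp only [Category.comp_id]

namespace IsHom

theorem comp {A B D : Alg V C} {f : A.carrier ⟶ B.carrier} {g : B.carrier ⟶ D.carrier}
    (hf : IsHom A B f) (hg : IsHom B D g) : IsHom A D (f ≫ g) := by
  intro n σ X a
  rw [← Category.assoc, hf, hg]
  simp only [Category.assoc]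

theorem inv {A B : Alg V C} {e : A.carrier ≅ B.carrier} (h : IsHom A B e.hom) :
    IsHom B A e.inv := by
  intro n σ X a
  rw [← cancel_mono e.hom, h]
  simp only [Category.assoc, e.inv_hom_id, Category.comp_id]

end IsHom

variable [CartesianMonoidalCategory C]

theorem isHom_fst (A B : Alg V C) : IsHom (A.prod B) A (fst A.carrier B.carrier) := by
  intro n σ X a
  simp only [Alg.app, Category.assoc, lift_fst]
  rw [← Category.assoc]
  congr 1
  ext
  simp

theorem isHom_snd (A B : Alg V C) : IsHom (A.prod B) B (snd A.carrier B.carrier) := by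
  intro n σ X a
  simp only [Alg.app, Category.assoc, lift_snd]
  rw [← Category.assoc]
  congr 1
  ext
  simp

theorem IsHom.of_fst_snd {A B D : Alg V C} {f : A.carrier ⟶ B.carrier ⊗ D.carrier}
    (h₁ : IsHom A B (f ≫ fst _ _)) (h₂ : IsHom A D (f ≫ snd _ _)) : IsHom A (B.prod D) f := by
  intro n σ X a
  apply CartesianMonoidalCategory.hom_ext
  · rw [Category.assoc, h₁, isHom_fst]
    simp only [Category.assoc]
  · rw [Category.assoc, h₂, isHom_snd]
    simp only [Category.assoc]

theorem isHom_associator (A B D : Alg V C) : IsHom ((A.prod B).prod D) (A.prod (B.prod D))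
    (α_ A.carrier B.carrier D.carrier).hom := by
  refine IsHom.of_fst_snd ?_ (IsHom.of_fst_snd ?_ ?_)
  · rw [associator_hom_fst]
    exact (isHom_fst (A.prod B) D).comp (isHom_fst A B)
  · rw [Category.assoc, associator_hom_snd_fst]
    exact (isHom_fst (A.prod B) D).comp (isHom_snd A B)
  · rw [Category.assoc, associator_hom_snd_snd]
    exact isHom_snd (A.prod B) D

theorem isHom_leftUnitor (A : Alg V C) : IsHom (Alg.unit.prod A) A (λ_ A.carrier).hom := by
  rw [leftUnitor_hom]
  exact isHom_snd Alg.unit A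

theorem isHom_rightUnitor (A : Alg V C) : IsHom (A.prod Alg.unit) A (ρ_ A.carrier).hom := by
  rw [rightUnitor_hom]
  exact isHom_fst A Alg.unit

theorem isHom_braiding [BraidedCategory C] (A B : Alg V C) :
    IsHom (A.prod B) (B.prod A) (β_ A.carrier B.carrier).hom := by
  refine IsHom.of_fst_snd ?_ ?_
  · rw [braiding_hom_fst]
    exact isHom_snd A B
  · rw [braiding_hom_snd]
    exact isHom_fst A B

variable [MonoidalClosed C] [HasSubobjectClassifier C] {Q : InternalQuantale C}
  {A B D A' B' : Alg V C}

theorem isAlgebraic_graph {f : A.carrier ⟶ B.carrier} (hf : IsHom A B f) :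
    IsAlgebraic Q A B (graph Q f) := by
  intro n σ X a b
  rw [(isJoin_prod (fun i => isStable_val_graph f (a i) (b i))
    fun i => isJoin_val_graph f (a i) (b i)).le_iff]
  rintro Z z _ ⟨t, ht, rfl⟩
  have ht1 : t = fun _ => 1 := funext fun i => (ht i).2
  have hσ : (z ≫ A.app σ a) ≫ f = z ≫ B.app σ b := by
    rw [Alg.comp_app, hf, Alg.comp_app]
    simp only [Category.assoc, (ht _).1]
  rw [comp_val, val_graph_eq_one f hσ, ht1]
  simpa only [List.ofFn_const, List.prod_replicate, one_pow] using InternalPoset.le_refl _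

theorem isAlgebraic_comp (hQ : Q.IsCommutative) {R : Rel Q A.carrier B.carrier}
    {S : Rel Q B.carrier D.carrier} (hR : IsAlgebraic Q A B R) (hS : IsAlgebraic Q B D S) :
    IsAlgebraic Q A D (comp R S) := by
  intro n σ X a d
  rw [(isJoin_prod (fun i => isStable_val_comp R S (a i) (d i))
    fun i => isJoin_val_comp R S (a i) (d i)).le_iff]
  rintro Z z _ ⟨t, ht, rfl⟩
  choose b hb using ht
  rw [comp_val, Alg.comp_app, Alg.comp_app, funext hb, hQ.prod_mul]
  exact (mul_le_mul (hR σ _ b) (hS σ b _)).trans (mul_le_val_comp R S _ _ _)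

theorem isAlgebraic_tensor (hQ : Q.IsCommutative) {R : Rel Q A.carrier B.carrier}
    {R' : Rel Q A'.carrier B'.carrier} (hR : IsAlgebraic Q A B R) (hR' : IsAlgebraic Q A' B' R') :
    IsAlgebraic Q (A.prod A') (B.prod B') (tensor R R') := by
  intro n σ X a b
  simp only [val_tensor]
  rw [hQ.prod_mul, isHom_fst, isHom_fst, isHom_snd, isHom_snd]
  exact mul_le_mul (hR σ _ _) (hR' σ _ _)

end Algebraic

section RelAlg

open QRel.Rel

variable {C : Type u} [Category.{v} C] [HasFiniteLimits C] [CartesianMonoidalCategory C]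
  [MonoidalClosed C] [HasSubobjectClassifier C]

/-- The category `Rel_(Σ, E)(Q)` of `(Σ, E)`-algebras and algebraic `Q`-relations, a type synonym of
`Alg V C`. -/
def RelAlg (V : Variety.{w}) (_ : InternalQuantale C) := Alg V C

namespace RelAlg

variable {V : Variety.{w}} {Q : InternalQuantale C} [hQ : Fact Q.IsCommutative]

noncomputable instance : Category.{v} (RelAlg V Q) where
  Hom A B := AlgRel Q A B
  id A := ⟨graph Q (𝟙 (Alg.carrier A)), isAlgebraic_graph (isHom_id A)⟩
  comp R S := ⟨Rel.comp R.1 S.1, isAlgebraic_comp hQ.out R.2 S.2⟩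
  id_comp R := Subtype.ext (Rel.id_comp R.1)
  comp_id R := Subtype.ext (Rel.comp_id R.1)
  assoc R S T := Subtype.ext (Rel.comp_assoc R.1 S.1 T.1)

variable (V Q) in
/-- The faithful functor to `Q`-relations between the carriers. -/
def forget : RelAlg V Q ⥤ RelCat Q where
  obj A := ⟨Alg.carrier A⟩
  map R := R.1

instance : (forget V Q).Faithful where
  map_injective h := Subtype.ext h

/-- The isomorphism given by the graphs of an invertible homomorphism and its inverse. -/
noncomputable def graphIso {A B : Alg V C} (e : A.carrier ≅ B.carrier) (he : IsHom A B e.hom) :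
    @Iso (RelAlg V Q) _ A B where
  hom := ⟨graph Q e.hom, isAlgebraic_graph he⟩
  inv := ⟨graph Q e.inv, isAlgebraic_graph he.inv⟩
  hom_inv_id := Subtype.ext ((RelCat.graphFunctor Q).mapIso e).hom_inv_id
  inv_hom_id := Subtype.ext ((RelCat.graphFunctor Q).mapIso e).inv_hom_id

noncomputable instance : MonoidalCategoryStruct (RelAlg V Q) where
  tensorObj A B := Alg.prod A B
  tensorUnit := Alg.unit
  tensorHom R S := ⟨tensor R.1 S.1, isAlgebraic_tensor hQ.out R.2 S.2⟩
  whiskerLeft A _ _ R := ⟨tensor (graph Q (𝟙 (Alg.carrier A))) R.1,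
    isAlgebraic_tensor hQ.out (isAlgebraic_graph (isHom_id A)) R.2⟩
  whiskerRight R A := ⟨tensor R.1 (graph Q (𝟙 (Alg.carrier A))),
    isAlgebraic_tensor hQ.out R.2 (isAlgebraic_graph (isHom_id A))⟩
  associator A B D := graphIso (α_ _ _ _) (isHom_associator A B D)
  leftUnitor A := graphIso (λ_ _) (isHom_leftUnitor A)
  rightUnitor A := graphIso (ρ_ _) (isHom_rightUnitor A)

noncomputable instance : MonoidalCategory (RelAlg V Q) :=
  MonoidalCategory.ofTensorHom
    (id_tensorHom_id := fun A B => (forget V Q).map_injective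
      (id_tensorHom_id ((forget V Q).obj A) ((forget V Q).obj B)))
    (id_tensorHom := fun _ _ _ _ => rfl)
    (tensorHom_id := fun _ _ => rfl)
    (tensorHom_comp_tensorHom := fun R R' S S' => (forget V Q).map_injective
      (tensorHom_comp_tensorHom ((forget V Q).map R) ((forget V Q).map R')
        ((forget V Q).map S) ((forget V Q).map S')))
    (associator_naturality := fun R S T => (forget V Q).map_injective
      (associator_naturality ((forget V Q).map R) ((forget V Q).map S) ((forget V Q).map T)))
    (leftUnitor_naturality := fun R => (forget V Q).map_injective
      (leftUnitor_naturality ((forget V Q).map R)))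
    (rightUnitor_naturality := fun R => (forget V Q).map_injective
      (rightUnitor_naturality ((forget V Q).map R)))
    (pentagon := fun A B D E => (forget V Q).map_injective
      (pentagon ((forget V Q).obj A) ((forget V Q).obj B) ((forget V Q).obj D)
        ((forget V Q).obj E)))
    (triangle := fun A B => (forget V Q).map_injective
      (triangle ((forget V Q).obj A) ((forget V Q).obj B)))

noncomputable instance [BraidedCategory C] : SymmetricCategory (RelAlg V Q) where
  braiding A B := graphIso (β_ _ _) (isHom_braiding A B)
  braiding_naturality_right A _ _ R := (forget V Q).map_injective
    (BraidedCategory.braiding_naturality_right ((forget V Q).obj A) ((forget V Q).map R))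
  braiding_naturality_left R A := (forget V Q).map_injective
    (BraidedCategory.braiding_naturality_left ((forget V Q).map R) ((forget V Q).obj A))
  hexagon_forward A B D := (forget V Q).map_injective
    (BraidedCategory.hexagon_forward ((forget V Q).obj A) ((forget V Q).obj B) ((forget V Q).obj D))
  hexagon_reverse A B D := (forget V Q).map_injective
    (BraidedCategory.hexagon_reverse ((forget V Q).obj A) ((forget V Q).obj B) ((forget V Q).obj D))
  symmetry A B := (forget V Q).map_injective
    (SymmetricCategory.symmetry ((forget V Q).obj A) ((forget V Q).obj B))

instance (A B : RelAlg V Q) : PartialOrder (A ⟶ B) where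
  le R S := Sub R.1 S.1
  le_refl R := Sub.refl R.1
  le_trans _ _ _ := Sub.trans
  le_antisymm _ _ h h' := Subtype.ext (h.antisymm h')

theorem isPartiallyOrderedSMC [BraidedCategory C] : IsPartiallyOrderedSMC (RelAlg V Q) where
  comp_mono := Rel.comp_mono
  tensor_mono := Rel.tensor_mono

end RelAlg

end RelAlg

end QRel

theorem mainTheorem12 {C : Type u} [Category.{v} C] [HasFiniteLimits C]
    [CartesianMonoidalCategory C] [BraidedCategory C] [MonoidalClosed C] [HasSubobjectClassifier C]
    (V : QRel.Variety.{w}) (Q : QRel.InternalQuantale C) (hQ : Q.IsCommutative) :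
    -- a symmetric monoidal category on the algebras, with ordered hom-sets
    ∃ (_ : Category.{v} (QRel.Alg V C)) (_ : MonoidalCategory (QRel.Alg V C))
      (_ : SymmetricCategory (QRel.Alg V C))
      (_ : ∀ A B : QRel.Alg V C, PartialOrder (A ⟶ B)),
      QRel.IsPartiallyOrderedSMC (QRel.Alg V C) ∧
    -- whose morphisms are the algebraic relations, with the pointwise order
    ∃ r : ∀ {A B : QRel.Alg V C}, (A ⟶ B) ≃ QRel.AlgRel Q A B,
      (∀ {A B : QRel.Alg V C} (f g : A ⟶ B), f ≤ g ↔ (r f).rel.Sub (r g).rel) ∧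
    -- with relational identities and composition
      (∀ A : QRel.Alg V C, (r (𝟙 A)).rel.IsIdentity) ∧
      (∀ {A B D : QRel.Alg V C} (f : A ⟶ B) (g : B ⟶ D),
        (r f).rel.IsComposite (r g).rel (r (f ≫ g)).rel) ∧
    -- whose tensor is the product of algebras and the pointwise product of relations
    ∃ (hU : 𝟙_ (QRel.Alg V C) = QRel.Alg.unit)
      (hT : ∀ A B : QRel.Alg V C, A ⊗ B = A.prod B),
      (∀ {A B A' B' : QRel.Alg V C} (f : A ⟶ B) (g : A' ⟶ B'),
        (r (f ⊗ₘ g)).relOf (hT A A') (hT B B') = (r f).rel.tensor (r g).rel) ∧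
    -- and whose coherence isomorphisms are the graphs of those of the finite products of `C`
      (∀ A B D : QRel.Alg V C,
        QRel.Rel.IsGraph (α_ A.carrier B.carrier D.carrier).hom
          ((r (α_ A B D).hom).relOf (A' := (A.prod B).prod D) (B' := A.prod (B.prod D))
            (by rw [hT, hT]) (by rw [hT, hT]))) ∧
      (∀ A : QRel.Alg V C,
        QRel.Rel.IsGraph (λ_ A.carrier).hom
          ((r (λ_ A).hom).relOf (A' := QRel.Alg.unit.prod A) (by rw [hT, hU]) rfl)) ∧
      (∀ A : QRel.Alg V C,
        QRel.Rel.IsGraph (ρ_ A.carrier).hom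
          ((r (ρ_ A).hom).relOf (A' := A.prod QRel.Alg.unit) (by rw [hT, hU]) rfl)) ∧
      (∀ A B : QRel.Alg V C,
        QRel.Rel.IsGraph (β_ A.carrier B.carrier).hom
          ((r (β_ A B).hom).relOf (hT A B) (hT B A))) := by
  have : Fact Q.IsCommutative := ⟨hQ⟩
  exact ⟨(inferInstance : Category.{v} (QRel.RelAlg V Q)),
    (inferInstance : MonoidalCategory (QRel.RelAlg V Q)),
    (inferInstance : SymmetricCategory (QRel.RelAlg V Q)),
    (inferInstance : ∀ A B : QRel.RelAlg V Q, PartialOrder (A ⟶ B)),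
    QRel.RelAlg.isPartiallyOrderedSMC, fun {A B} => Equiv.refl _, fun _ _ => Iff.rfl,
    fun A => QRel.Rel.isIdentity_graph_id Q A.carrier,
    fun f g => QRel.Rel.isComposite_comp f.1 g.1, rfl, fun _ _ => rfl, fun _ _ => rfl,
    fun _ _ _ => QRel.Rel.isGraph_graph Q _, fun _ => QRel.Rel.isGraph_graph Q _,
    fun _ => QRel.Rel.isGraph_graph Q _, fun _ _ => QRel.Rel.isGraph_graph Q _⟩
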